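/- Let $X$ be a Banach space over $\mathbb{R}$ or $\mathbb{C}$ with dual space $X^*$ and closed dual unit ball $B_{X^*}$. For $A\subset X^*$ let \[A^{(1)}=\bigcup_{n=1}^\infty \overline{A\cap nB_{X^*}}^{\,w^*},\] where $\overline{\,\cdot\,}^{\,w^*}$ denotes closure in the weak$^*$ topology; that is, $A^{(1)}$ is the set of all limits of bounded weak$^*$ convergent nets in $A$. The space $X$ is called quasi-reflexive if the canonical image of $X$ in $X^{**}$ has finite codimension (in particular, reflexive spaces are quasi-reflexive). Then $X^*$ contains a linear subspace $A$ for which $A^{(1)}$ is a proper, norm-dense subset of $X^*$ if and only if $X$ is not quasi-reflexive and $X$ contains an infinite-dimensional closed subspace $Z$ whose dual $Z^*$ is separable in the norm topology. -/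

import Mathlib

/-- The weak* derived set `A⁽¹⁾ = ⋃ₙ closure_{w*} (A ∩ n B_{X*})`, `n = 1, 2, …`, of a subset `A`
of the dual `X*` of a normed space `X`. -/
def weakStarDerivedSet (𝕜 : Type*) [RCLike 𝕜] {X : Type*} [NormedAddCommGroup X]
    [NormedSpace 𝕜 X] (A : Set (StrongDual 𝕜 X)) : Set (StrongDual 𝕜 X) :=
  ⋃ n : ℕ, ⋃ _ : 1 ≤ n,
    StrongDual.toWeakDual ⁻¹'
      closure (StrongDual.toWeakDual '' (A ∩ Metric.closedBall (0 : StrongDual 𝕜 X) (n : ℝ)))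

/-- A normed space `X` is quasi-reflexive if the canonical image of `X` in `X**` has finite
codimension, i.e. `X** = X ⊕ F` with `F` finite-dimensional (so reflexive spaces are
quasi-reflexive, with `F = 0`). -/
def IsQuasiReflexive (𝕜 : Type*) [RCLike 𝕜] (X : Type*) [NormedAddCommGroup X]
    [NormedSpace 𝕜 X] : Prop :=
  ∃ F : Submodule 𝕜 (StrongDual 𝕜 (StrongDual 𝕜 X)), Module.Finite 𝕜 F ∧
    IsCompl (LinearMap.range (NormedSpace.inclusionInDoubleDual 𝕜 X).toLinearMap) F

open Filter Topology Metric NormedSpace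

/-! ### Sequences built one term at a time -/

section Recursion

/-! By Helly's theorem, `g` lies in the derived set of `A` iff `‖g x‖ ≤ C * ‖evalOn A x‖` for some
`C` (`mem_weakStarDerivedSet_iff`). So density makes `T = evalOn A` injective, and properness keeps
`T` from being bounded below. On a quasi-reflexive space an injective `T` has closed range, hence is
bounded below (`exists_norm_le_of_cofinite`): contradiction. Moreover there is a biorthogonal system
`x n`, `e n` with `T (x n)` decaying faster than `‖e n‖` grows (`exists_biorthogonal_norm_map_le`).
On the closed span `Z` of the `x n`, each `g` in the derived set equals the norm convergent series
`∑ g (x n) • e n`, so by density `Z*` is separable.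

Conversely, take `d n` in `X*` dense modulo the annihilator of `Z`, and `w n` in `X**`, `φ n` in
`X***` with `φ n` zero on `X` and `φ n (w m)` triangular. Helly approximations produce iterated
limits that do not commute (`exists_asymptotic_system`): `v m (g t) = φ n (w m)` for late `t`, yet
`v m (γ n) = 0` at the weak* limit `γ n` of the `g t`. Let `K = ∑ a m • (v m ⊗ d m)` be small, `R =
(1 + K)⁻¹`, and let `A` be the image under `R` of the annihilator of unit vectors `z j ∈ Z` with `d
i (z j) = 0` for `i < j`. Then `A` almost vanishes at `z j` for large `j`, so its derived set is
proper; but weak* limits of `R (g t)` put every `R (d n)` into it, and it contains `R` of the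
annihilator of `Z`, so it is dense. -/

theorem exists_seq_of_step {α : Type*} [Nonempty α] (P : ℕ → (ℕ → α) → Prop)
    (hcongr : ∀ n f g, (∀ i ≤ n, f i = g i) → P n f → P n g)
    (hstep : ∀ n f, (∀ i < n, P i f) → ∃ a, P n (Function.update f n a)) :
    ∃ f, ∀ n, P n f := by
  have h : ∀ n f, ∃ a, (∀ i < n, P i f) → P n (Function.update f n a) := by
    intro n f
    by_cases hf : ∀ i < n, P i f
    · obtain ⟨a, ha⟩ := hstep n f hf
      exact ⟨a, fun _ => ha⟩
    · exact ⟨Classical.arbitrary α, fun h => absurd h hf⟩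
  choose s hs using h
  let F : ℕ → (ℕ → α) := fun n => Nat.rec (fun _ => Classical.arbitrary α)
    (fun n f => Function.update f n (s n f)) n
  have hF : ∀ n, F (n + 1) = Function.update (F n) n (s n (F n)) := fun n => rfl
  have hP : ∀ n, ∀ i < n, P i (F n) := by
    intro n
    induction n with
    | zero => intro i hi; omega
    | succ n ih =>
      intro i hi
      rw [hF]
      rcases Nat.lt_succ_iff_lt_or_eq.1 hi with hi | rfl
      · refine hcongr i (F n) _ (fun j hj => ?_) (ih i hi)
        rw [Function.update_of_ne (by omega)]
      · exact hs _ _ ih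
  have heq : ∀ n, ∀ i < n, F n i = F (i + 1) i := by
    intro n
    induction n with
    | zero => intro i hi; omega
    | succ n ih =>
      intro i hi
      rcases Nat.lt_succ_iff_lt_or_eq.1 hi with hi | rfl
      · rw [hF, Function.update_of_ne (by omega), ih i hi]
      · rfl
  -- Entry `n` is final from stage `n + 1` on, so the diagonal agrees with `F (n + 1)` up to `n`.
  exact ⟨fun n => F (n + 1) n, fun n =>
    hcongr n (F (n + 1)) _ (fun i hi => heq (n + 1) i (Nat.lt_succ_of_le hi))
      (hP (n + 1) n n.lt_succ_self)⟩

end Recursion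

/-! ### Helly's theorem and weak* compactness -/

section Duality

variable {𝕜 : Type*} [RCLike 𝕜] {E : Type*} [NormedAddCommGroup E] [NormedSpace 𝕜 E]

/-- **Helly's theorem** on the approximate solvability of finite systems of linear equations. -/
theorem exists_norm_le_forall_apply_eq {ι : Type*} [Finite ι] (f : ι → StrongDual 𝕜 E)
    (p : ι → 𝕜) {C : ℝ} (hC : 0 < C)
    (h : ∀ c : ι → 𝕜, ‖∑ᶠ i, c i * p i‖ ≤ C * ‖∑ᶠ i, c i • f i‖) :
    ∃ x, ‖x‖ ≤ C + 1 ∧ ∀ i, f i x = p i := by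
  classical
  have := Fintype.ofFinite ι
  let _ : NormedSpace ℝ E := NormedSpace.restrictScalars ℝ 𝕜 E
  have : IsScalarTower ℝ 𝕜 E := IsScalarTower.of_algebraMap_smul fun _ _ => rfl
  simp only [finsum_eq_sum_of_fintype] at h
  let L : E →L[𝕜] (ι → 𝕜) := ContinuousLinearMap.pi f
  -- Otherwise Hahn–Banach separates `p` from the image of the ball by some `l`, and the
  -- coefficients of `l` violate `h`.
  have hcl : p ∈ closure (L '' closedBall 0 C) := by
    by_contra hp
    have hconv : Convex ℝ (closure (L '' closedBall (0 : E) C)) :=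
      ((convex_closedBall (0 : E) C).is_linear_image
        ((L.toLinearMap.restrictScalars ℝ).isLinear)).closure
    obtain ⟨l, u, hl, hu⟩ := RCLike.geometric_hahn_banach_closed_point (𝕜 := 𝕜) hconv
      isClosed_closure hp
    have hrep : ∀ q : ι → 𝕜, l q = ∑ i, l (Pi.single i 1) * q i := by
      intro q
      calc l q = l (∑ i, q i • Pi.single i 1) := by
            congr 1
            ext j
            simp [Finset.sum_apply, Pi.single_apply]
        _ = ∑ i, l (Pi.single i 1) * q i := by simp [mul_comm]
    set g : StrongDual 𝕜 E := ∑ i, l (Pi.single i 1) • f i with hg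
    have hgL : ∀ x, g x = l (L x) := by
      intro x
      rw [hrep]
      simp [hg, L]
    have hb : ‖g‖ ≤ u / C := by
      refine ContinuousLinearMap.opNorm_bound_of_ball_bound hC u g fun z hz => ?_
      obtain ⟨c, hc, hcz⟩ := RCLike.exists_norm_eq_mul_self (g z)
      have h1 : c • z ∈ closedBall (0 : E) C := by
        simpa [norm_smul, hc] using hz
      have h2 := hl _ (subset_closure ⟨_, h1, rfl⟩)
      rw [← hgL, map_smul, smul_eq_mul, ← hcz, RCLike.ofReal_re] at h2
      exact h2.le
    have h3 := h fun i => l (Pi.single i 1)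
    rw [← hrep] at h3
    have h4 : C * ‖g‖ ≤ u := by
      rw [le_div_iff₀ hC] at hb; linarith
    have h5 := RCLike.re_le_norm (l p)
    linarith
  have hrange : p ∈ LinearMap.range L.toLinearMap := by
    have hc : IsClosed (LinearMap.range L.toLinearMap : Set (ι → 𝕜)) :=
      Submodule.closed_of_finiteDimensional _
    refine (closure_minimal ?_ hc) hcl
    rintro _ ⟨x, -, rfl⟩
    exact ⟨x, rfl⟩
  -- A bounded right inverse on the finite-dimensional range corrects an approximate solution to an
  -- exact one; the tolerance `1 / (‖s‖ + 1)` keeps the correction within norm 1.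
  obtain ⟨σ, hσ⟩ := L.toLinearMap.rangeRestrict.exists_rightInverse_of_surjective
    (LinearMap.range_rangeRestrict _)
  let s := LinearMap.toContinuousLinearMap σ
  have hs : ∀ q : LinearMap.range L.toLinearMap, L (s q) = q := fun q =>
    congrArg Subtype.val (LinearMap.congr_fun hσ q)
  obtain ⟨_, ⟨x, hx, rfl⟩, hxp⟩ := Metric.mem_closure_iff.1 hcl (1 / (‖s‖ + 1)) (by positivity)
  let q : LinearMap.range L.toLinearMap := ⟨p, hrange⟩ - ⟨L x, x, rfl⟩
  have hq : ‖q‖ ≤ 1 / (‖s‖ + 1) := by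
    have : ‖q‖ = dist p (L x) := by rw [dist_eq_norm]; rfl
    rw [this]; exact hxp.le
  refine ⟨x + s q, ?_, fun i => ?_⟩
  · have h1 : ‖s q‖ ≤ 1 := by
      calc ‖s q‖ ≤ ‖s‖ * ‖q‖ := s.le_opNorm q
        _ ≤ (‖s‖ + 1) * (1 / (‖s‖ + 1)) := by gcongr; linarith
        _ = 1 := by field_simp
    have h2 : ‖x‖ ≤ C := by simpa using hx
    exact (norm_add_le _ _).trans (by linarith)
  · have : L (x + s q) = p := by
      rw [map_add, hs]
      simp [q]
    exact congrFun this i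

/-- **Helly's theorem** for functionals on the dual: they agree with evaluations on finite sets. -/
theorem exists_norm_le_forall_apply_eq_of_dual {V : Type*} [NormedAddCommGroup V] [NormedSpace 𝕜 V]
    (e : V ≃ₗᵢ[𝕜] StrongDual 𝕜 E) (ψ : StrongDual 𝕜 V) {s : Set V} (hs : s.Finite) :
    ∃ x, ‖x‖ ≤ ‖ψ‖ + 2 ∧ ∀ v ∈ s, e v x = ψ v := by
  have := hs.to_subtype
  obtain ⟨x, hx, hfx⟩ := exists_norm_le_forall_apply_eq (fun v : s => e v)
    (fun v => ψ v) (C := ‖ψ‖ + 1) (by positivity) (fun c => by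
      have := Fintype.ofFinite s
      simp only [finsum_eq_sum_of_fintype]
      have h1 : ∑ i, c i * ψ i = ψ (∑ i, c i • (i : V)) := by simp
      have h2 : ∑ i, c i • e i = e (∑ i, c i • (i : V)) := by simp
      rw [h1, h2, e.norm_map]
      refine (ψ.le_opNorm _).trans ?_
      gcongr
      linarith)
  exact ⟨x, by linarith, fun v hv => hfx ⟨v, hv⟩⟩

/-- Banach–Alaoglu; an ultrafilter takes the place of a convergent subnet. -/
theorem exists_tendsto_apply_of_bounded {ι : Type*} (U : Ultrafilter ι)
    (f : ι → StrongDual 𝕜 E) {C : ℝ} (h : ∀ᶠ i in U, ‖f i‖ ≤ C) :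
    ∃ ψ : StrongDual 𝕜 E, ∀ x, Tendsto (fun i => f i x) U (𝓝 (ψ x)) := by
  have hc := WeakDual.isCompact_closedBall (𝕜 := 𝕜) (0 : StrongDual 𝕜 E) C
  obtain ⟨ψ, -, hψ⟩ := hc.ultrafilter_le_nhds (U.map fun i => StrongDual.toWeakDual (f i)) (by
    rw [le_principal_iff, Ultrafilter.coe_map, mem_map]
    filter_upwards [h] with i hi
    simpa using hi)
  refine ⟨WeakDual.toStrongDual ψ, ?_⟩
  have : Tendsto (fun i => StrongDual.toWeakDual (f i)) U (𝓝 ψ) := hψ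
  rw [tendsto_iff_forall_eval_tendsto_topDualPairing] at this
  exact this

/-- An infinite-dimensional space has nonzero vectors in the joint kernel of finitely many
functionals. -/
theorem exists_ne_zero_forall_apply_eq_zero (h : ¬ FiniteDimensional 𝕜 E)
    {s : Set (StrongDual 𝕜 E)} (hs : s.Finite) : ∃ x : E, ‖x‖ = 1 ∧ ∀ f ∈ s, f x = 0 := by
  have := hs.to_subtype
  have h1 : ∃ x : E, x ≠ 0 ∧ ∀ f ∈ s, f x = 0 := by
    by_contra! hx
    refine h (FiniteDimensional.of_injective
      (LinearMap.pi fun f : s => (f : StrongDual 𝕜 E).toLinearMap) ?_)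
    rw [injective_iff_map_eq_zero]
    intro x hx0
    by_contra hne
    obtain ⟨f, hf, hfx⟩ := hx x hne
    exact hfx (congrFun hx0 ⟨f, hf⟩)
  obtain ⟨x, hx, hf⟩ := h1
  exact ⟨((‖x‖⁻¹ : ℝ) : 𝕜) • x, by simp [norm_smul, hx], fun f hfs => by simp [hf f hfs]⟩

end Duality

/-! ### The derived set of a subspace -/

section DerivedSet

variable {𝕜 : Type*} [RCLike 𝕜] {X : Type*} [NormedAddCommGroup X] [NormedSpace 𝕜 X]

/-- A subspace of `X*`, regarded as a normed space in its own right. -/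
def DualSubspace (A : Submodule 𝕜 (StrongDual 𝕜 X)) : Type _ := A

noncomputable instance (A : Submodule 𝕜 (StrongDual 𝕜 X)) : NormedAddCommGroup (DualSubspace A) :=
  inferInstanceAs (NormedAddCommGroup A)

noncomputable instance (A : Submodule 𝕜 (StrongDual 𝕜 X)) : NormedSpace 𝕜 (DualSubspace A) :=
  inferInstanceAs (NormedSpace 𝕜 A)

/-- The inclusion of a subspace of `X*`. -/
noncomputable def DualSubspace.incl (A : Submodule 𝕜 (StrongDual 𝕜 X)) :
    DualSubspace A →L[𝕜] StrongDual 𝕜 X := A.subtypeL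

theorem DualSubspace.incl_mem (A : Submodule 𝕜 (StrongDual 𝕜 X)) (f : DualSubspace A) :
    DualSubspace.incl A f ∈ A := Subtype.property (p := (· ∈ A)) f

theorem DualSubspace.norm_incl (A : Submodule 𝕜 (StrongDual 𝕜 X)) (f : DualSubspace A) :
    ‖DualSubspace.incl A f‖ = ‖f‖ := rfl

theorem DualSubspace.exists_incl_eq {A : Submodule 𝕜 (StrongDual 𝕜 X)} {f : StrongDual 𝕜 X}
    (hf : f ∈ A) : ∃ f' : DualSubspace A, DualSubspace.incl A f' = f := ⟨(⟨f, hf⟩ : A), rfl⟩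

/-- The canonical map of `X` into the dual of a subspace `A` of `X*`. -/
noncomputable def evalOn (A : Submodule 𝕜 (StrongDual 𝕜 X)) :
    X →L[𝕜] StrongDual 𝕜 (DualSubspace A) :=
  (DualSubspace.incl A).flip

theorem evalOn_apply (A : Submodule 𝕜 (StrongDual 𝕜 X)) (x : X) (f : DualSubspace A) :
    evalOn A x f = DualSubspace.incl A f x := rfl

theorem mem_weakStarDerivedSet_of_tendsto {A : Set (StrongDual 𝕜 X)} {ι : Type*} {l : Filter ι}
    [l.NeBot] {f : ι → StrongDual 𝕜 X} {g : StrongDual 𝕜 X} {C : ℝ}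
    (hA : ∀ᶠ i in l, f i ∈ A) (hC : ∀ᶠ i in l, ‖f i‖ ≤ C)
    (h : ∀ x, Tendsto (fun i => f i x) l (𝓝 (g x))) : g ∈ weakStarDerivedSet 𝕜 A := by
  obtain ⟨n, hn⟩ := exists_nat_ge (max C 1)
  simp only [weakStarDerivedSet, Set.mem_iUnion, Set.mem_preimage]
  refine ⟨n, by exact_mod_cast (le_max_right _ _).trans hn, ?_⟩
  have ht : Tendsto (fun i => StrongDual.toWeakDual (f i)) l (𝓝 (StrongDual.toWeakDual g)) := by
    rw [tendsto_iff_forall_eval_tendsto_topDualPairing]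
    exact h
  refine mem_closure_of_tendsto ht ?_
  filter_upwards [hA, hC] with i h1 h2
  exact ⟨f i, ⟨h1, by simpa using h2.trans ((le_max_left _ _).trans hn)⟩, rfl⟩

theorem exists_bound_of_mem_weakStarDerivedSet {A : Set (StrongDual 𝕜 X)} {g : StrongDual 𝕜 X}
    (hg : g ∈ weakStarDerivedSet 𝕜 A) :
    ∃ C : ℝ, 0 ≤ C ∧ ∀ x r, (∀ f ∈ A, ‖f‖ ≤ C → ‖f x‖ ≤ r) → ‖g x‖ ≤ r := by
  simp only [weakStarDerivedSet, Set.mem_iUnion, Set.mem_preimage] at hg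
  obtain ⟨n, -, hg⟩ := hg
  refine ⟨n, by positivity, fun x r hx => ?_⟩
  have hc : IsClosed {φ : WeakDual 𝕜 X | ‖φ x‖ ≤ r} :=
    isClosed_le (WeakDual.eval_continuous x).norm continuous_const
  refine closure_minimal ?_ hc hg
  rintro _ ⟨f, ⟨hf, hfn⟩, rfl⟩
  exact hx f hf (by simpa using hfn)

/-- A pointwise bound over a ball of `A` survives weak* limits. Conversely, Helly's theorem in `A`
matches `g` on each finite subset of `X` by an element of `A`, with a uniform norm bound; these form
a net converging to `g`. -/
theorem mem_weakStarDerivedSet_iff {A : Submodule 𝕜 (StrongDual 𝕜 X)} {g : StrongDual 𝕜 X} :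
    g ∈ weakStarDerivedSet 𝕜 (A : Set (StrongDual 𝕜 X)) ↔
      ∃ C : ℝ, ∀ x, ‖g x‖ ≤ C * ‖evalOn A x‖ := by
  constructor
  · intro hg
    obtain ⟨C, hC, h⟩ := exists_bound_of_mem_weakStarDerivedSet hg
    refine ⟨C, fun x => h x _ fun f hf hfC => ?_⟩
    obtain ⟨f, rfl⟩ := DualSubspace.exists_incl_eq hf
    rw [DualSubspace.norm_incl] at hfC
    calc ‖DualSubspace.incl A f x‖ = ‖evalOn A x f‖ := rfl
      _ ≤ ‖evalOn A x‖ * ‖f‖ := (evalOn A x).le_opNorm _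
      _ ≤ C * ‖evalOn A x‖ := by rw [mul_comm]; gcongr
  · rintro ⟨C, hC⟩
    have key : ∀ s : Finset X, ∃ f : DualSubspace A, ‖f‖ ≤ |C| + 1 + 1 ∧ ∀ x ∈ s,
        DualSubspace.incl A f x = g x := by
      intro s
      obtain ⟨f, hf, hfx⟩ := exists_norm_le_forall_apply_eq (fun x : s => evalOn A x)
        (fun x => g x) (C := |C| + 1) (by positivity) (fun c => by
          simp only [finsum_eq_sum_of_fintype]
          have h1 : ∑ i, c i * g i = g (∑ i, c i • (i : X)) := by simp
          have h2 : ∑ i, c i • evalOn A i = evalOn A (∑ i, c i • (i : X)) := by simp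
          rw [h1, h2]
          refine (hC _).trans ?_
          gcongr
          linarith [le_abs_self C])
      exact ⟨f, hf, fun x hx => hfx ⟨x, hx⟩⟩
    choose f hf hfx using key
    refine mem_weakStarDerivedSet_of_tendsto (l := atTop) 
      (f := fun s => DualSubspace.incl A (f s))
      (Eventually.of_forall fun s => DualSubspace.incl_mem A (f s)) (Eventually.of_forall hf) fun x => ?_
    refine tendsto_const_nhds.congr' ?_
    filter_upwards [eventually_ge_atTop {x}] with s hs
    exact (hfx s x (hs (by simp))).symm

theorem weakStarDerivedSet_add {A : Submodule 𝕜 (StrongDual 𝕜 X)} {f g : StrongDual 𝕜 X}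
    (hf : f ∈ weakStarDerivedSet 𝕜 (A : Set (StrongDual 𝕜 X)))
    (hg : g ∈ weakStarDerivedSet 𝕜 (A : Set (StrongDual 𝕜 X))) :
    f + g ∈ weakStarDerivedSet 𝕜 (A : Set (StrongDual 𝕜 X)) := by
  rw [mem_weakStarDerivedSet_iff] at *
  obtain ⟨C, hC⟩ := hf
  obtain ⟨D, hD⟩ := hg
  refine ⟨C + D, fun x => (norm_add_le _ _).trans ?_⟩
  rw [add_mul]
  exact add_le_add (hC x) (hD x)

theorem weakStarDerivedSet_smul {A : Submodule 𝕜 (StrongDual 𝕜 X)} {f : StrongDual 𝕜 X} (c : 𝕜)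
    (hf : f ∈ weakStarDerivedSet 𝕜 (A : Set (StrongDual 𝕜 X))) :
    c • f ∈ weakStarDerivedSet 𝕜 (A : Set (StrongDual 𝕜 X)) := by
  rw [mem_weakStarDerivedSet_iff] at *
  obtain ⟨C, hC⟩ := hf
  refine ⟨‖c‖ * C, fun x => ?_⟩
  rw [smul_apply, norm_smul, mul_assoc]
  gcongr
  exact hC x

/-- The weak* derived set of a subspace, as a subspace. -/
def weakStarDerivedSubmodule (A : Submodule 𝕜 (StrongDual 𝕜 X)) :
    Submodule 𝕜 (StrongDual 𝕜 X) where
  carrier := weakStarDerivedSet 𝕜 (A : Set (StrongDual 𝕜 X))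
  add_mem' := weakStarDerivedSet_add
  zero_mem' := mem_weakStarDerivedSet_iff.2 ⟨0, by simp⟩
  smul_mem' c _ := weakStarDerivedSet_smul c

theorem le_weakStarDerivedSubmodule (A : Submodule 𝕜 (StrongDual 𝕜 X)) :
    A ≤ weakStarDerivedSubmodule A := fun f hf =>
  mem_weakStarDerivedSet_of_tendsto (l := (pure () : Filter Unit)) (f := fun _ => f) (C := ‖f‖)
    (by simpa using hf) (by simp) fun x => tendsto_const_nhds

theorem evalOn_injective_of_dense {A : Submodule 𝕜 (StrongDual 𝕜 X)}
    (hA : Dense (weakStarDerivedSet 𝕜 (A : Set (StrongDual 𝕜 X)))) :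
    Function.Injective (evalOn A) := by
  rw [injective_iff_map_eq_zero]
  intro x hx
  refine SeparatingDual.eq_zero_of_forall_dual_eq_zero (R := 𝕜) fun g => ?_
  have hc : IsClosed {f : StrongDual 𝕜 X | f x = 0} :=
    isClosed_eq (inclusionInDoubleDual 𝕜 X x).continuous continuous_const
  refine closure_minimal (fun f hf => ?_) hc (hA g)
  obtain ⟨C, hC⟩ := mem_weakStarDerivedSet_iff.1 hf
  simpa [hx] using hC x

theorem weakStarDerivedSet_eq_univ_of_antilipschitz {A : Submodule 𝕜 (StrongDual 𝕜 X)} {C : ℝ}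
    (h : ∀ x, ‖x‖ ≤ C * ‖evalOn A x‖) :
    weakStarDerivedSet 𝕜 (A : Set (StrongDual 𝕜 X)) = Set.univ := by
  refine Set.eq_univ_of_forall fun g => mem_weakStarDerivedSet_iff.2 ⟨‖g‖ * C, fun x => ?_⟩
  rw [mul_assoc]
  exact (g.le_opNorm x).trans (by gcongr; exact h x)

end DerivedSet

/-! ### Finite codimension through finite spanning sets -/

section QuasiReflexive

theorem Submodule.exists_isCompl_finite_iff {K V : Type*} [Field K] [AddCommGroup V] [Module K V]
    (N : Submodule K V) : (∃ F : Submodule K V, Module.Finite K F ∧ IsCompl N F) ↔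
      ∃ t : Finset V, ∀ v, ∃ n ∈ N, ∃ c : V → K, n + ∑ w ∈ t, c w • w = v := by
  constructor
  · rintro ⟨F, hF, hc⟩
    obtain ⟨t, rfl⟩ := Module.Finite.iff_fg.1 hF
    refine ⟨t, fun v => ?_⟩
    obtain ⟨n, hn, f, hf, h⟩ := Submodule.mem_sup.1 (hc.sup_eq_top ▸ Submodule.mem_top (x := v))
    obtain ⟨c, -, rfl⟩ := Submodule.mem_span_finset.1 hf
    exact ⟨n, hn, c, h⟩
  · rintro ⟨t, ht⟩
    obtain ⟨F, hF⟩ := N.exists_isCompl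
    have hc : N.CoFG := by
      refine Submodule.FG.cofg_of_codisjoint (S := Submodule.span K t) ?_ ⟨t, rfl⟩
      rw [codisjoint_iff, eq_top_iff]
      intro v _
      obtain ⟨n, hn, c, h⟩ := ht v
      rw [sup_comm]
      exact Submodule.mem_sup.2 ⟨n, hn, _, Submodule.sum_mem _ fun w hw =>
        Submodule.smul_mem _ _ (Submodule.subset_span hw), h⟩
    exact ⟨F, (N.quotientEquivOfIsCompl F hF).finiteDimensional, hF⟩

theorem StrongDual.exists_isCompl_finite_iff {𝕜 E : Type*} [RCLike 𝕜] [AddCommGroup E]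
    [TopologicalSpace E] [Module 𝕜 E] (N : Submodule 𝕜 (StrongDual 𝕜 E)) :
    (∃ F : Submodule 𝕜 (StrongDual 𝕜 E), Module.Finite 𝕜 F ∧ IsCompl N F) ↔
      ∃ t : Finset (StrongDual 𝕜 E), ∀ v, ∃ n ∈ N, ∃ c : StrongDual 𝕜 E → 𝕜,
        n + ∑ w ∈ t, c w • w = v :=
  Submodule.exists_isCompl_finite_iff (V := StrongDual 𝕜 E) N

variable {𝕜 : Type*} [RCLike 𝕜] {X : Type*} [NormedAddCommGroup X] [NormedSpace 𝕜 X]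

theorem isQuasiReflexive_iff : IsQuasiReflexive 𝕜 X ↔
    ∃ t : Finset (StrongDual 𝕜 (StrongDual 𝕜 X)), ∀ v, ∃ x : X,
      ∃ c : StrongDual 𝕜 (StrongDual 𝕜 X) → 𝕜,
        inclusionInDoubleDual 𝕜 X x + ∑ w ∈ t, c w • w = v := by
  refine (StrongDual.exists_isCompl_finite_iff _).trans ?_
  simp only [LinearMap.mem_range, exists_exists_eq_and]
  rfl

end QuasiReflexive

/-! ### The canonical embedding into the bidual -/

section NormedDual

variable (𝕜 : Type*) [RCLike 𝕜] (X : Type*) [NormedAddCommGroup X] [NormedSpace 𝕜 X]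

/-- The dual of a normed space, as a normed space with no other structure. -/
def NormedDual : Type _ := StrongDual 𝕜 X

noncomputable instance : NormedAddCommGroup (NormedDual 𝕜 X) :=
  inferInstanceAs (NormedAddCommGroup (StrongDual 𝕜 X))

noncomputable instance : NormedSpace 𝕜 (NormedDual 𝕜 X) :=
  inferInstanceAs (NormedSpace 𝕜 (StrongDual 𝕜 X))

instance : CompleteSpace (NormedDual 𝕜 X) := inferInstanceAs (CompleteSpace (StrongDual 𝕜 X))

/-- The identification of `NormedDual 𝕜 X` with the dual of `X`. -/
noncomputable def NormedDual.equiv : NormedDual 𝕜 X ≃ₗᵢ[𝕜] StrongDual 𝕜 X :=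
  LinearIsometryEquiv.refl 𝕜 (StrongDual 𝕜 X)

/-- The canonical embedding into the bidual. -/
noncomputable def bidualEmbedding : X →L[𝕜] StrongDual 𝕜 (NormedDual 𝕜 X) :=
  (NormedDual.equiv 𝕜 X).toContinuousLinearEquiv.toContinuousLinearMap.flip

variable {𝕜 X}

@[simp]
theorem bidualEmbedding_apply (x : X) (f : NormedDual 𝕜 X) :
    bidualEmbedding 𝕜 X x f = NormedDual.equiv 𝕜 X f x := rfl

theorem norm_bidualEmbedding (x : X) : ‖bidualEmbedding 𝕜 X x‖ = ‖x‖ := by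
  refine le_antisymm (ContinuousLinearMap.opNorm_le_bound _ (norm_nonneg _) fun f => ?_) ?_
  · rw [bidualEmbedding_apply, mul_comm, ← (NormedDual.equiv 𝕜 X).norm_map]
    exact (NormedDual.equiv 𝕜 X f).le_opNorm x
  · obtain ⟨g, hg, hgx⟩ := exists_dual_vector'' 𝕜 x
    have h := (bidualEmbedding 𝕜 X x).le_of_opNorm_le_of_le le_rfl
      (((NormedDual.equiv 𝕜 X).symm.norm_map g).trans_le hg)
    simpa [hgx] using h

theorem isQuasiReflexive_iff_normedDual : IsQuasiReflexive 𝕜 X ↔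
    ∃ t : Finset (StrongDual 𝕜 (NormedDual 𝕜 X)), ∀ v, ∃ x : X,
      ∃ c : StrongDual 𝕜 (NormedDual 𝕜 X) → 𝕜,
        bidualEmbedding 𝕜 X x + ∑ w ∈ t, c w • w = v :=
  isQuasiReflexive_iff

end NormedDual

/-! ### Necessity: consequences of a dense proper derived set -/

section Necessity

variable {𝕜 : Type*} [RCLike 𝕜] {X : Type*} [NormedAddCommGroup X] [NormedSpace 𝕜 X]

theorem Submodule.isClosed_of_isCompl_of_le {M F N : Submodule 𝕜 X} (h : IsCompl M F)
    [FiniteDimensional 𝕜 F] (hM : IsClosed (M : Set X)) (hN : M ≤ N) : IsClosed (N : Set X) := by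
  have : FiniteDimensional 𝕜 (X ⧸ M) := (M.quotientEquivOfIsCompl F h).symm.finiteDimensional
  exact Submodule.isClosed_mono_of_finiteDimensional_quotient hM hN

/-- If `J` is an isometric embedding with range of finite codimension and `ρ` is a quotient map such
that `T = ρ ∘ J` is injective, then `T` is bounded below. -/
theorem exists_norm_le_of_cofinite [CompleteSpace X] {V G : Type*} [NormedAddCommGroup V]
    [NormedSpace 𝕜 V] [CompleteSpace V] [NormedAddCommGroup G] [NormedSpace 𝕜 G] [CompleteSpace G]
    {T : X →L[𝕜] G} (hi : Function.Injective T) (J : X →L[𝕜] V) (hJ : ∀ x, ‖J x‖ = ‖x‖)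
    (hfin : ∃ t : Finset V, ∀ v, ∃ x : X, ∃ c : V → 𝕜, J x + ∑ w ∈ t, c w • w = v)
    (ρ : V →L[𝕜] G) (hρ : Function.Surjective ρ) (hT : ∀ x, ρ (J x) = T x) :
    ∃ C : ℝ, ∀ x, ‖x‖ ≤ C * ‖T x‖ := by
  obtain ⟨F, hF, hc⟩ := (LinearMap.range J.toLinearMap).exists_isCompl_finite_iff.2 <| by
    simpa using hfin
  have hM : IsClosed (LinearMap.range J.toLinearMap : Set V) :=
    (AddMonoidHomClass.isometry_of_norm J hJ).isClosedEmbedding.isClosed_range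
  -- This sum is the preimage under `ρ` of the range of `T`. It is closed since it contains a closed
  -- subspace of finite codimension, and `ρ` is a quotient map, so the range of `T` is closed.
  have hcl : IsClosed ((LinearMap.range J.toLinearMap ⊔ LinearMap.ker ρ.toLinearMap :
      Submodule 𝕜 V) : Set V) := Submodule.isClosed_of_isCompl_of_le hc hM le_sup_left
  have hrange : IsClosed (Set.range T) := by
    rw [← ((ρ.isOpenMap hρ).isQuotientMap ρ.continuous hρ).isClosed_preimage]
    convert hcl using 1
    rw [← Submodule.comap_map_eq, Submodule.comap_coe, Submodule.map_coe,
      LinearMap.coe_range, ← Set.range_comp]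
    exact congrArg (fun f : X → G => ρ ⁻¹' Set.range f) (funext fun x => (hT x).symm)
  obtain ⟨K, hK⟩ := T.antilipschitz_of_injective_of_isClosed_range hi hrange
  exact ⟨K, fun x => by simpa using hK.le_mul_dist x 0⟩

/-- `T` is the adjoint of `i` restricted to `X`, and `h` says that this adjoint is onto. -/
theorem IsQuasiReflexive.exists_norm_le_flip [CompleteSpace X] (hX : IsQuasiReflexive 𝕜 X)
    {B : Type*} [NormedAddCommGroup B] [NormedSpace 𝕜 B] (i : B →L[𝕜] NormedDual 𝕜 X)
    (T : X →L[𝕜] StrongDual 𝕜 B) (hT : ∀ x b, T x b = NormedDual.equiv 𝕜 X (i b) x)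
    (h : ∀ φ : StrongDual 𝕜 B, ∃ ψ : StrongDual 𝕜 (NormedDual 𝕜 X), ψ ∘L i = φ)
    (hi : Function.Injective T) : ∃ C : ℝ, ∀ x, ‖x‖ ≤ C * ‖T x‖ :=
  exists_norm_le_of_cofinite hi (bidualEmbedding 𝕜 X) norm_bidualEmbedding
    (isQuasiReflexive_iff_normedDual.1 hX) (ContinuousLinearMap.precomp 𝕜 i) h fun x =>
      ContinuousLinearMap.ext fun b => (hT x b).symm

/-- A subspace of the dual of a quasi-reflexive space that separates points is norming. -/
theorem IsQuasiReflexive.exists_norm_le_evalOn [CompleteSpace X] (hX : IsQuasiReflexive 𝕜 X)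
    {A : Submodule 𝕜 (StrongDual 𝕜 X)} (hA : Function.Injective (evalOn A)) :
    ∃ C : ℝ, ∀ x, ‖x‖ ≤ C * ‖evalOn A x‖ :=
  hX.exists_norm_le_flip
    ((NormedDual.equiv 𝕜 X).symm.toContinuousLinearEquiv.toContinuousLinearMap ∘L
      DualSubspace.incl A) (evalOn A) (fun _ _ => rfl)
    (fun φ => by
      obtain ⟨ψ, hψ, -⟩ := exists_extension_norm_eq A φ
      exact ⟨ψ ∘L (NormedDual.equiv 𝕜 X).toContinuousLinearEquiv.toContinuousLinearMap,
        ContinuousLinearMap.ext fun f => hψ f⟩) hA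

/-- An injective operator which is not bounded below is not bounded below on any closed subspace of
finite codimension either. -/
theorem exists_norm_eq_one_norm_map_le [CompleteSpace X] {G : Type*} [NormedAddCommGroup G]
    [NormedSpace 𝕜 G] [CompleteSpace G] {T : X →L[𝕜] G} (hT : Function.Injective T)
    (hb : ¬ ∃ C : ℝ, ∀ x, ‖x‖ ≤ C * ‖T x‖) {s : Set (StrongDual 𝕜 X)} (hs : s.Finite)
    {ε : ℝ} (hε : 0 < ε) : ∃ x, ‖x‖ = 1 ∧ ‖T x‖ ≤ ε ∧ ∀ f ∈ s, f x = 0 := by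
  by_contra! hcon
  have := hs.to_subtype
  let p : X →L[𝕜] (s → 𝕜) := ContinuousLinearMap.pi fun f => (f : StrongDual 𝕜 X)
  let W := LinearMap.ker p.toLinearMap
  have hW : ∀ x ∈ W, ‖x‖ ≤ ε⁻¹ * ‖T x‖ := by
    intro x hx
    rcases eq_or_ne x 0 with rfl | hx0
    · simp
    by_contra! hlt
    have hpos : 0 < ‖x‖ := norm_pos_iff.2 hx0
    obtain ⟨f, hf, hfx⟩ := hcon (((‖x‖⁻¹ : ℝ) : 𝕜) • x) (by simp [norm_smul, hx0]) (by
      rw [inv_mul_lt_iff₀ hε] at hlt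
      rw [map_smul, norm_smul]
      simp only [RCLike.norm_ofReal, abs_inv, abs_norm]
      rw [inv_mul_le_iff₀ hpos]
      linarith)
    have h0 : f x = 0 := congrFun (show p x = 0 from hx) ⟨f, hf⟩
    exact hfx (by simp [h0])
  have hWc : IsClosed (W : Set X) := p.isClosed_ker
  have : CompleteSpace W := hWc.completeSpace_coe
  -- `T` is bounded below on `W`, so `T(W)` is closed. The full range adds only finitely many
  -- dimensions, so it is closed too, and injectivity makes `T` bounded below on `X`.
  have hcl : IsClosed (W.map T.toLinearMap : Set G) := by
    have ha : AntilipschitzWith (Real.toNNReal ε⁻¹) (T ∘L W.subtypeL) :=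
      AddMonoidHomClass.antilipschitz_of_bound _ fun x => by
        rw [Real.coe_toNNReal _ (by positivity)]
        exact hW x x.2
    convert ha.isClosed_range (T ∘L W.subtypeL).uniformContinuous using 1
    ext y
    simp
  have hco : W.CoFG := Submodule.CoFG.ker _
  have hr : IsClosed (Set.range T) :=
    LinearMap.isClosed_range_of_isClosed_map_of_finiteDimensional_quotient hcl
  obtain ⟨K, hK⟩ := T.antilipschitz_of_injective_of_isClosed_range hT hr
  exact hb ⟨K, fun x => by simpa using hK.le_mul_dist x 0⟩

/-- A normalized biorthogonal system along which an injective operator that is not bounded below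
decays rapidly. -/
theorem exists_biorthogonal_norm_map_le [CompleteSpace X] {G : Type*} [NormedAddCommGroup G]
    [NormedSpace 𝕜 G] [CompleteSpace G] {T : X →L[𝕜] G} (hT : Function.Injective T)
    (hb : ¬ ∃ C : ℝ, ∀ x, ‖x‖ ≤ C * ‖T x‖) :
    ∃ (x : ℕ → X) (e : ℕ → StrongDual 𝕜 X), (∀ n, ‖T (x n)‖ ≤ (1 / 4) ^ n) ∧
      (∀ n, ‖e n‖ ≤ 2 ^ n) ∧ (∀ n, e n (x n) = 1) ∧ ∀ m n, m ≠ n → e m (x n) = 0 := by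
  let P : ℕ → (ℕ → X × StrongDual 𝕜 X) → Prop := fun n f =>
    ‖(f n).1‖ = 1 ∧ ‖T (f n).1‖ ≤ (1 / 4) ^ n ∧ ‖(f n).2‖ ≤ 2 ^ n ∧ (f n).2 (f n).1 = 1 ∧
      ∀ i < n, (f n).2 (f i).1 = 0 ∧ (f i).2 (f n).1 = 0
  obtain ⟨f, hf⟩ := exists_seq_of_step P (fun n f g hfg hP => by
      obtain ⟨h1, h2, h3, h4, h5⟩ := hP
      have hn := hfg n le_rfl
      refine ⟨hn ▸ h1, hn ▸ h2, hn ▸ h3, hn ▸ h4, fun i hi => ?_⟩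
      rw [← hn, ← hfg i hi.le]
      exact h5 i hi) (fun n f hf => by
    obtain ⟨x, hx1, hTx, hx⟩ := exists_norm_eq_one_norm_map_le hT hb
      (s := (fun i => (f i).2) '' Set.Iio n) ((Set.finite_Iio n).image _)
      (ε := (1 / 4) ^ n) (by positivity)
    have hx' : ∀ i < n, (f i).2 x = 0 := fun i hi => hx _ ⟨i, hi, rfl⟩
    obtain ⟨φ, hφ, hφx⟩ := exists_dual_vector 𝕜 x (by simp [hx1])
    have hbi : ∀ i < n, ∀ j < n, (f i).2 (f j).1 = if i = j then 1 else 0 := by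
      intro i hi j hj
      rcases lt_trichotomy i j with h | rfl | h
      · rw [if_neg h.ne]; exact ((hf j hj).2.2.2.2 i h).2
      · rw [if_pos rfl]; exact (hf i hi).2.2.2.1
      · rw [if_neg h.ne']; exact ((hf i hi).2.2.2.2 j h).1
    -- The sum makes the norming functional `φ` vanish at the earlier vectors; the norm bound
    -- follows from `1 + ∑ i < n, 2 ^ i = 2 ^ n`.
    refine ⟨(x, φ - ∑ i ∈ Finset.range n, φ (f i).1 • (f i).2), ?_⟩
    simp only [P, Function.update_self]
    refine ⟨hx1, hTx, ?_, ?_, fun i hi => ?_⟩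
    · calc ‖φ - ∑ i ∈ Finset.range n, φ (f i).1 • (f i).2‖
          ≤ 1 + ∑ i ∈ Finset.range n, 2 ^ i := by
            refine (norm_sub_le _ _).trans (add_le_add hφ.le (norm_sum_le_of_le _ fun i hi => ?_))
            have hi' := hf i (Finset.mem_range.1 hi)
            rw [norm_smul]
            have h1 : ‖φ (f i).1‖ ≤ 1 := by
              simpa [hφ, hi'.1] using φ.le_opNorm (f i).1
            calc _ ≤ 1 * (2 : ℝ) ^ i := by gcongr; exact hi'.2.2.1
              _ = 2 ^ i := one_mul _
        _ = 2 ^ n := by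
            rw [geom_sum_eq (by norm_num)]
            ring
    · have : ∑ i ∈ Finset.range n, φ (f i).1 * (f i).2 x = 0 :=
        Finset.sum_eq_zero fun i hi => by rw [hx' i (Finset.mem_range.1 hi), mul_zero]
      simp [this, hφx, hx1]
    · rw [Function.update_of_ne hi.ne]
      refine ⟨?_, hx' i hi⟩
      have : ∑ j ∈ Finset.range n, φ (f j).1 * (f j).2 (f i).1 = φ (f i).1 := by
        rw [Finset.sum_eq_single_of_mem i (Finset.mem_range.2 hi)]
        · rw [hbi i hi i hi, if_pos rfl, mul_one]
        · intro j hj hji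
          rw [hbi j (Finset.mem_range.1 hj) i hi, if_neg hji, mul_zero]
      simp [this])
  refine ⟨fun n => (f n).1, fun n => (f n).2, fun n => (hf n).2.1, fun n => (hf n).2.2.1,
    fun n => (hf n).2.2.2.1, fun m n hmn => ?_⟩
  rcases lt_or_gt_of_ne hmn with h | h
  · exact ((hf n).2.2.2.2 m h).2
  · exact ((hf m).2.2.2.2 n h).1

theorem exists_subspace_separable_dual [CompleteSpace X] {A : Submodule 𝕜 (StrongDual 𝕜 X)}
    (hne : weakStarDerivedSet 𝕜 (A : Set (StrongDual 𝕜 X)) ≠ Set.univ)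
    (hd : Dense (weakStarDerivedSet 𝕜 (A : Set (StrongDual 𝕜 X)))) :
    ∃ Z : Submodule 𝕜 X, IsClosed (Z : Set X) ∧ ¬ FiniteDimensional 𝕜 Z ∧
      TopologicalSpace.SeparableSpace (StrongDual 𝕜 Z) := by
  obtain ⟨x, e, hx, he, he1, he0⟩ := exists_biorthogonal_norm_map_le
    (evalOn_injective_of_dense hd)
    fun ⟨C, hC⟩ => hne (weakStarDerivedSet_eq_univ_of_antilipschitz hC)
  have hexp : ∀ m n, e m (x n) = if m = n then 1 else 0 := fun m n => by
    split_ifs with h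
    · rw [h, he1]
    · exact he0 m n h
  set Z := (Submodule.span 𝕜 (Set.range x)).topologicalClosure with hZ
  have hxZ : ∀ n, x n ∈ Z := fun n =>
    Submodule.le_topologicalClosure _ (Submodule.subset_span ⟨n, rfl⟩)
  refine ⟨Z, Submodule.isClosed_topologicalClosure _, fun hfin => ?_, ?_⟩
  · have hli : LinearIndependent 𝕜 fun n => (⟨x n, hxZ n⟩ : Z) := by
      rw [linearIndependent_iff']
      intro s c hc i hi
      have h1 := congrArg (fun z : Z => e i z) hc
      simpa [hexp, hi] using h1
    exact not_finite_iff_infinite.2 inferInstance hli.finite_of_isNoetherian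
  · let r : StrongDual 𝕜 X →L[𝕜] StrongDual 𝕜 Z := ContinuousLinearMap.precomp 𝕜 Z.subtypeL
    let S : Submodule 𝕜 (StrongDual 𝕜 Z) :=
      (Submodule.span 𝕜 (Set.range fun n => r (e n))).topologicalClosure
    have hS : ∀ g : StrongDual 𝕜 X, r g ∈ S := by
      have hcl : IsClosed {g : StrongDual 𝕜 X | r g ∈ S} :=
        (Submodule.isClosed_topologicalClosure _).preimage r.continuous
      refine fun g => closure_minimal (fun g hg => ?_) hcl (hd g)
      obtain ⟨C, hC⟩ := mem_weakStarDerivedSet_iff.1 hg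
      have hC0 : ∀ n, ‖g (x n)‖ ≤ |C| * (1 / 4) ^ n := fun n => by
        refine (hC _).trans ?_
        gcongr
        · exact le_abs_self C
        · exact hx n
      -- Decay `4⁻ⁿ` against growth `2ⁿ` leaves a geometric series. By biorthogonality its sum
      -- agrees with `g` at each `x n`, hence on `Z`.
      have hsum : Summable fun n => g (x n) • e n := by
        refine Summable.of_norm_bounded (g := fun n => |C| * (1 / 2) ^ n)
          ((summable_geometric_of_lt_one (by norm_num) (by norm_num)).mul_left _) fun n => ?_
        rw [norm_smul]
        calc _ ≤ (|C| * (1 / 4) ^ n) * 2 ^ n := by gcongr; exacts [hC0 n, he n]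
          _ = |C| * (1 / 2) ^ n := by rw [mul_assoc, ← mul_pow]; norm_num
      obtain ⟨G, hG⟩ := hsum
      have hGx : ∀ n, G (x n) = g (x n) := by
        intro n
        have h1 : HasSum (fun m => g (x m) * e m (x n)) (G (x n)) :=
          hG.mapL (inclusionInDoubleDual 𝕜 X (x n))
        refine h1.unique ?_
        convert hasSum_ite_eq n (g (x n)) using 2 with m
        rw [hexp]
        split_ifs with h
        · rw [h, mul_one]
        · rw [mul_zero]
      have hrG : r g = r G := by
        have hle : Z ≤ LinearMap.ker (g - G).toLinearMap := by
          refine Submodule.topologicalClosure_minimal _ ?_ (g - G).isClosed_ker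
          rw [Submodule.span_le]
          rintro _ ⟨n, rfl⟩
          simp [hGx n]
        ext z
        exact sub_eq_zero.1 (hle z.2)
      rw [Set.mem_ofPred_eq, hrG]
      refine mem_closure_of_tendsto (hG.mapL r) (Eventually.of_forall fun s => ?_)
      refine Submodule.sum_mem _ fun n _ => ?_
      rw [map_smul]
      exact Submodule.smul_mem _ _ (Submodule.subset_span ⟨n, rfl⟩)
    have hsep : TopologicalSpace.IsSeparable (S : Set (StrongDual 𝕜 Z)) :=
      (Set.countable_range _).isSeparable.span.closure
    rw [← TopologicalSpace.isSeparable_univ_iff]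
    refine hsep.mono fun ψ _ => ?_
    obtain ⟨g, hg, -⟩ := exists_extension_norm_eq Z ψ
    have : r g = ψ := ContinuousLinearMap.ext hg
    exact this ▸ hS g

theorem not_isQuasiReflexive_of_dense [CompleteSpace X] {A : Submodule 𝕜 (StrongDual 𝕜 X)}
    (hne : weakStarDerivedSet 𝕜 (A : Set (StrongDual 𝕜 X)) ≠ Set.univ)
    (hd : Dense (weakStarDerivedSet 𝕜 (A : Set (StrongDual 𝕜 X)))) : ¬ IsQuasiReflexive 𝕜 X :=
  fun hX => hne <| by
    obtain ⟨C, hC⟩ := hX.exists_norm_le_evalOn (evalOn_injective_of_dense hd)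
    exact weakStarDerivedSet_eq_univ_of_antilipschitz hC

end Necessity

/-! ### Triangular systems modulo a closed subspace -/

section Independence

variable {𝕜 : Type*} [RCLike 𝕜] {X V : Type*} [NormedAddCommGroup X] [NormedSpace 𝕜 X]
  [NormedAddCommGroup V] [NormedSpace 𝕜 V]

theorem exists_dual_apply_eq_one_of_notMem {M : Submodule 𝕜 V} (hM : IsClosed (M : Set V)) {w : V}
    (hw : w ∉ M) : ∃ φ : StrongDual 𝕜 V, (∀ x ∈ M, φ x = 0) ∧ φ w = 1 := by
  have : IsClosed (M : Set V) := hM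
  have hq : ‖M.mkQ w‖ ≠ 0 := by
    rw [norm_ne_zero_iff]
    simpa using hw
  obtain ⟨g, -, hg⟩ := exists_dual_vector 𝕜 (M.mkQ w) hq
  refine ⟨((‖M.mkQ w‖⁻¹ : ℝ) : 𝕜) • g ∘L M.mkQL, fun x hx => ?_, ?_⟩
  · have : M.mkQL x = 0 := (Submodule.Quotient.mk_eq_zero M).2 hx
    simp [this]
  · have h : g (M.mkQL w) = ‖M.mkQ w‖ := hg
    rw [smul_apply, ContinuousLinearMap.comp_apply, h, smul_eq_mul, ← RCLike.ofReal_mul,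
      inv_mul_cancel₀ hq, RCLike.ofReal_one]

/-- Modulo a closed subspace of infinite codimension there is an infinite triangular system. -/
theorem exists_triangular_system {M : Submodule 𝕜 V} (hM : IsClosed (M : Set V))
    (hinf : ¬ M.CoFG) : ∃ (w : ℕ → V) (φ : ℕ → StrongDual 𝕜 V), (∀ n, ∀ x ∈ M, φ n x = 0) ∧
      (∀ n, φ n (w n) = 1) ∧ ∀ m n, n < m → φ n (w m) = 0 := by
  let P : ℕ → (ℕ → V × StrongDual 𝕜 V) → Prop := fun n f =>
    (∀ x ∈ M, (f n).2 x = 0) ∧ (f n).2 (f n).1 = 1 ∧ ∀ i < n, (f i).2 (f n).1 = 0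
  obtain ⟨f, hf⟩ := exists_seq_of_step P (fun n f g hfg hP => by
      have hn := hfg n le_rfl
      refine ⟨hn ▸ hP.1, hn ▸ hP.2.1, fun i hi => ?_⟩
      rw [← hn, ← hfg i hi.le]
      exact hP.2.2 i hi) (fun n f _ => by
    -- If not, `M` contains the joint kernel of finitely many functionals and has finite
    -- codimension.
    have hex : ∃ w, w ∉ M ∧ ∀ i < n, (f i).2 w = 0 := by
      by_contra! hcon
      refine hinf (Submodule.CoFG.of_le (S := LinearMap.ker
        (LinearMap.pi fun i : Fin n => (f i).2.toLinearMap)) (fun w hw => ?_)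
        (Submodule.CoFG.ker _))
      by_contra hwM
      obtain ⟨i, hi, hne⟩ := hcon w hwM
      exact hne (congrFun hw ⟨i, hi⟩)
    obtain ⟨w, hw, hw0⟩ := hex
    obtain ⟨φ, hφ, hφw⟩ := exists_dual_apply_eq_one_of_notMem hM hw
    refine ⟨(w, φ), ?_⟩
    simp only [P, Function.update_self]
    refine ⟨hφ, hφw, fun i hi => ?_⟩
    rw [Function.update_of_ne hi.ne]
    exact hw0 i hi)
  exact ⟨fun n => (f n).1, fun n => (f n).2, fun n => (hf n).1, fun n => (hf n).2.1,
    fun m n h => (hf m).2.2 n h⟩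

theorem exists_triangular_system_of_not_cofinite [CompleteSpace X] (J : X →L[𝕜] V)
    (hJ : ∀ x, ‖J x‖ = ‖x‖)
    (hinf : ¬ ∃ t : Finset V, ∀ v, ∃ x : X, ∃ c : V → 𝕜, J x + ∑ w ∈ t, c w • w = v) :
    ∃ (w : ℕ → V) (φ : ℕ → StrongDual 𝕜 V), (∀ n x, φ n (J x) = 0) ∧
      (∀ n, φ n (w n) = 1) ∧ ∀ m n, n < m → φ n (w m) = 0 := by
  have hM : IsClosed (LinearMap.range J.toLinearMap : Set V) :=
    (AddMonoidHomClass.isometry_of_norm J hJ).isClosedEmbedding.isClosed_range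
  obtain ⟨w, φ, h0, h⟩ := exists_triangular_system hM fun hco => hinf <| by
    obtain ⟨F, hF⟩ := (LinearMap.range J.toLinearMap).exists_isCompl
    have := (Submodule.exists_isCompl_finite_iff _).1
      ⟨F, ((LinearMap.range J.toLinearMap).quotientEquivOfIsCompl F hF).finiteDimensional, hF⟩
    simpa using this
  exact ⟨w, φ, fun n x => h0 n _ ⟨x, rfl⟩, h⟩

end Independence

/-! ### Sequences with non-commuting iterated limits -/

section Construction

variable {𝕜 : Type*} [RCLike 𝕜] {X D V : Type*} [NormedAddCommGroup X] [NormedSpace 𝕜 X]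
  [NormedAddCommGroup D] [NormedSpace 𝕜 D] [NormedAddCommGroup V] [NormedSpace 𝕜 V]

/-- Every space whose subspace `Z` has a separable dual carries a sequence of functionals whose
restrictions to `Z` are dense in the dual of `Z`. -/
theorem exists_seq_approx_modulo_annihilator (eD : D ≃ₗᵢ[𝕜] StrongDual 𝕜 X) (Z : Submodule 𝕜 X)
    [TopologicalSpace.SeparableSpace (StrongDual 𝕜 Z)] : ∃ d : ℕ → D, ∀ f : D, ∀ ε > 0,
      ∃ n r, (∀ z ∈ Z, eD r z = 0) ∧ ‖f - (d n + r)‖ < ε := by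
  let s := TopologicalSpace.denseSeq (StrongDual 𝕜 Z)
  have hs : DenseRange s := TopologicalSpace.denseRange_denseSeq _
  choose d hd _ using fun n => exists_extension_norm_eq Z (s n)
  refine ⟨fun n => eD.symm (d n), fun f ε hε => ?_⟩
  obtain ⟨n, hn⟩ := hs.exists_dist_lt ((eD f) ∘L Z.subtypeL) hε
  -- A norm-preserving extension of the error on `Z`; removing it leaves a functional that
  -- annihilates `Z`.
  obtain ⟨r, hr, hrn⟩ := exists_extension_norm_eq Z ((eD f) ∘L Z.subtypeL - s n)
  refine ⟨n, f - eD.symm (d n) - eD.symm r, fun z hz => ?_, ?_⟩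
  · have h1 := hr ⟨z, hz⟩
    have h2 := hd n ⟨z, hz⟩
    simp only [sub_apply, ContinuousLinearMap.comp_apply,
      Submodule.subtypeL_apply] at h1 h2
    simp [h1, h2]
  · rw [dist_eq_norm] at hn
    have : f - (eD.symm (d n) + (f - eD.symm (d n) - eD.symm r)) = eD.symm r := by abel
    rw [this, eD.symm.norm_map, hrn]
    exact hn

/-- The inductive construction of the vectors and functionals from which a subspace with dense
proper derived set is built. -/
theorem exists_interlaced_sequences (eD : D ≃ₗᵢ[𝕜] StrongDual 𝕜 X) (eV : V ≃ₗᵢ[𝕜] StrongDual 𝕜 D)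
    (J : X →L[𝕜] V) (hJ : ∀ x f, eV (J x) f = eD f x) {Z : Submodule 𝕜 X}
    (hZ : ¬ FiniteDimensional 𝕜 Z) (d : ℕ → D) (w : ℕ → V) (φ : ℕ → StrongDual 𝕜 V)
    (hφ : ∀ n x, φ n (J x) = 0) (idx : ℕ → ℕ) :
    ∃ (z : ℕ → X) (g : ℕ → D) (y : ℕ → X), (∀ t, z t ∈ Z) ∧ (∀ t, ‖z t‖ = 1) ∧
      (∀ t, ∀ i < t, eD (d i) (z t) = 0) ∧ (∀ s t, eD (g s) (z t) = 0) ∧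
      (∀ t, ∀ i < t, eD (g t) (y i) = 0) ∧
      (∀ t, ∀ m ≤ t, eV (w m) (g t) = φ (idx t) (w m)) ∧ (∀ t, ‖g t‖ ≤ ‖φ (idx t)‖ + 2) ∧
      (∀ t, ∀ i ≤ t, eD (g i) (y t) = eV (w (idx t)) (g i)) ∧
      ∀ t, ‖y t‖ ≤ ‖w (idx t)‖ + 2 := by
  let P : ℕ → (ℕ → X × D × X) → Prop := fun t f =>
    ((f t).1 ∈ Z ∧ ‖(f t).1‖ = 1 ∧ ‖(f t).2.1‖ ≤ ‖φ (idx t)‖ + 2 ∧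
      ‖(f t).2.2‖ ≤ ‖w (idx t)‖ + 2 ∧ (∀ i < t, eD (d i) (f t).1 = 0) ∧
      (∀ m ≤ t, eV (w m) (f t).2.1 = φ (idx t) (w m)) ∧ eD (f t).2.1 (f t).1 = 0 ∧
      eD (f t).2.1 (f t).2.2 = eV (w (idx t)) (f t).2.1) ∧
    ∀ i < t, eD (f i).2.1 (f t).1 = 0 ∧ eD (f t).2.1 (f i).1 = 0 ∧ eD (f t).2.1 (f i).2.2 = 0 ∧
      eD (f i).2.1 (f t).2.2 = eV (w (idx t)) (f i).2.1
  obtain ⟨f, hf⟩ := exists_seq_of_step P (fun t f g hfg hP => by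
      have ht := hfg t le_rfl
      refine ⟨ht ▸ hP.1, fun i hi => ?_⟩
      rw [← ht, ← hfg i hi.le]
      exact hP.2 i hi) (fun t f _ => by
    have hfin : (Set.Iio t).Finite := Set.finite_Iio t
    obtain ⟨⟨z, hzZ⟩, hz1, hz⟩ := exists_ne_zero_forall_apply_eq_zero hZ
      (s := (fun i => eD (d i) ∘L Z.subtypeL) '' Set.Iio t ∪
        (fun i => eD (f i).2.1 ∘L Z.subtypeL) '' Set.Iio t)
      ((hfin.image _).union (hfin.image _))
    have hzd : ∀ i < t, eD (d i) z = 0 := fun i hi => hz _ (Or.inl ⟨i, hi, rfl⟩)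
    have hzg : ∀ i < t, eD (f i).2.1 z = 0 := fun i hi => hz _ (Or.inr ⟨i, hi, rfl⟩)
    -- Since `φ (idx t)` vanishes on `J`, matching it at `J z` and at the earlier vectors forces `g`
    -- to kill them.
    obtain ⟨g, hg1, hg⟩ := exists_norm_le_forall_apply_eq_of_dual eV (φ (idx t))
      (s := {J z} ∪ w '' Set.Iic t ∪ ((fun i => J (f i).1) '' Set.Iio t ∪
        (fun i => J (f i).2.2) '' Set.Iio t))
      (((Set.finite_singleton _).union ((Set.finite_Iic t).image _)).union
        ((hfin.image _).union (hfin.image _)))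
    have hgz : eD g z = 0 := by
      rw [← hJ, hg _ (Or.inl (Or.inl rfl)), hφ]
    have hgw : ∀ m ≤ t, eV (w m) g = φ (idx t) (w m) := fun m hm =>
      hg _ (Or.inl (Or.inr ⟨m, hm, rfl⟩))
    have hgz' : ∀ i < t, eD g (f i).1 = 0 := fun i hi => by
      rw [← hJ, hg _ (Or.inr (Or.inl ⟨i, hi, rfl⟩)), hφ]
    have hgy' : ∀ i < t, eD g (f i).2.2 = 0 := fun i hi => by
      rw [← hJ, hg _ (Or.inr (Or.inr ⟨i, hi, rfl⟩)), hφ]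
    obtain ⟨y, hy1, hy⟩ := exists_norm_le_forall_apply_eq_of_dual eD (eV (w (idx t)))
      (s := {g} ∪ (fun i => (f i).2.1) '' Set.Iio t)
      ((Set.finite_singleton _).union (hfin.image _))
    rw [eV.norm_map] at hy1
    refine ⟨(z, g, y), ?_⟩
    simp only [P, Function.update_self]
    refine ⟨⟨hzZ, hz1, hg1, hy1, hzd, hgw, hgz, hy g (Or.inl rfl)⟩, fun i hi => ?_⟩
    rw [Function.update_of_ne hi.ne]
    exact ⟨hzg i hi, hgz' i hi, hgy' i hi, hy _ (Or.inr ⟨i, hi, rfl⟩)⟩)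
  refine ⟨fun t => (f t).1, fun t => (f t).2.1, fun t => (f t).2.2, fun t => (hf t).1.1,
    fun t => (hf t).1.2.1, fun t => (hf t).1.2.2.2.2.1, fun s t => ?_,
    fun t i hi => ((hf t).2 i hi).2.2.1, fun t => (hf t).1.2.2.2.2.2.1,
    fun t => (hf t).1.2.2.1, fun t i hi => ?_, fun t => (hf t).1.2.2.2.1⟩
  · rcases lt_trichotomy s t with h | rfl | h
    · exact ((hf t).2 s h).1
    · exact (hf s).1.2.2.2.2.2.2.1
    · exact ((hf s).2 t h).2.1
  · rcases hi.lt_or_eq with h | rfl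
    · exact ((hf t).2 i h).2.2.2
    · exact (hf i).1.2.2.2.2.2.2.2

/-- Pairing visits each index infinitely often, so a limit can be taken along the stages devoted to
`n`. -/
theorem exists_ultrafilter_unpair_fst_eq (n : ℕ) :
    ∃ U : Ultrafilter ℕ, (U : Filter ℕ) ≤ atTop ∧ ∀ᶠ t in U, (Nat.unpair t).1 = n := by
  have : (atTop ⊓ 𝓟 {t : ℕ | (Nat.unpair t).1 = n}).NeBot := by
    rw [← frequently_mem_iff_neBot, frequently_atTop]
    exact fun N => ⟨Nat.pair n N, Nat.right_le_pair n N, by simp⟩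
  exact ⟨Ultrafilter.of _, (Ultrafilter.of_le _).trans inf_le_left,
    (Ultrafilter.of_le _).trans inf_le_right (mem_principal_self _)⟩

/-- The limiting objects of the inductive construction. -/
theorem exists_asymptotic_system (eD : D ≃ₗᵢ[𝕜] StrongDual 𝕜 X) (eV : V ≃ₗᵢ[𝕜] StrongDual 𝕜 D)
    (J : X →L[𝕜] V) (hJ : ∀ x f, eV (J x) f = eD f x) (hJ1 : ∀ x, ‖J x‖ = ‖x‖)
    {Z : Submodule 𝕜 X} (hZ : ¬ FiniteDimensional 𝕜 Z) (d : ℕ → D) (w : ℕ → V)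
    (φ : ℕ → StrongDual 𝕜 V) (hφ : ∀ n x, φ n (J x) = 0) :
    ∃ (z : ℕ → X) (g : ℕ → D) (v : ℕ → StrongDual 𝕜 D) (γ : ℕ → D) (U : ℕ → Ultrafilter ℕ),
      (∀ t, z t ∈ Z) ∧ (∀ t, ‖z t‖ = 1) ∧ (∀ t, ∀ i < t, eD (d i) (z t) = 0) ∧
      (∀ s t, eD (g s) (z t) = 0) ∧ (∀ n, (U n : Filter ℕ) ≤ atTop) ∧
      (∀ n, ∀ᶠ t in U n, ‖g t‖ ≤ ‖φ n‖ + 2) ∧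
      (∀ n, ∀ᶠ t in U n, ∀ m ≤ t, v m (g t) = φ n (w m)) ∧
      (∀ n x, Tendsto (fun t => eD (g t) x) (U n) (𝓝 (eD (γ n) x))) ∧
      (∀ n t, eD (γ n) (z t) = 0) ∧ ∀ m n, v m (γ n) = 0 := by
  obtain ⟨z, g, y, hzZ, hz1, hzd, hgz, hgy, hgw, hg1, hyg, hy1⟩ :=
    exists_interlaced_sequences eD eV J hJ hZ d w φ hφ (fun t => (Nat.unpair t).1)
  choose U hU hUn using exists_ultrafilter_unpair_fst_eq
  have hgb : ∀ n, ∀ᶠ t in U n, ‖g t‖ ≤ ‖φ n‖ + 2 := fun n => by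
    filter_upwards [hUn n] with t ht
    exact ht ▸ hg1 t
  choose v hv using fun m => exists_tendsto_apply_of_bounded (U m) (fun t => eV (J (y t)))
    (C := ‖w m‖ + 2) (by
      filter_upwards [hUn m] with t ht
      rw [eV.norm_map, hJ1]
      exact ht ▸ hy1 t)
  choose γ hγ using fun n => exists_tendsto_apply_of_bounded (U n) (fun t => eD (g t))
    (C := ‖φ n‖ + 2) (by simpa using hgb n)
  -- With `i` fixed, late `y t` reproduce `w m` at `g i`; below, with `y i` fixed, late `g t` vanish
  -- at it. The order of limits decides the value.
  have hvg : ∀ m i, v m (g i) = eV (w m) (g i) := fun m i => by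
    refine tendsto_nhds_unique (hv m (g i)) (tendsto_const_nhds.congr' ?_)
    filter_upwards [hUn m, hU m (eventually_ge_atTop i)] with t ht hit
    rw [hJ, hyg t i hit, ht]
  have hγy : ∀ n i, γ n (y i) = 0 := fun n i => by
    refine tendsto_nhds_unique (hγ n (y i)) (tendsto_const_nhds.congr' ?_)
    filter_upwards [hU n (eventually_gt_atTop i)] with t hit
    exact (hgy t i hit).symm
  refine ⟨z, g, v, fun n => eD.symm (γ n), U, hzZ, hz1, hzd, hgz, hU, hgb, fun n => ?_,
    fun n x => by simpa using hγ n x, fun n t => ?_, fun m n => ?_⟩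
  · filter_upwards [hUn n] with t ht m hm
    rw [hvg, hgw t m hm, ht]
  · rw [eD.apply_symm_apply]
    refine tendsto_nhds_unique (hγ n (z t)) (tendsto_const_nhds.congr fun s => (hgz s t).symm)
  · refine tendsto_nhds_unique (hv m (eD.symm (γ n))) (tendsto_const_nhds.congr fun t => ?_)
    rw [hJ, eD.apply_symm_apply, hγy]

end Construction

/-! ### Sufficiency: perturbing an annihilator -/

section Sufficiency

variable {𝕜 : Type*} [RCLike 𝕜] {X D : Type*} [NormedAddCommGroup X] [NormedSpace 𝕜 X]
  [NormedAddCommGroup D] [NormedSpace 𝕜 D]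

theorem exists_hasSum_rankOne_norm_lt_one [CompleteSpace D] (v : ℕ → StrongDual 𝕜 D) (d : ℕ → D) :
    ∃ (a : ℕ → 𝕜) (K : D →L[𝕜] D), (∀ m, a m ≠ 0) ∧
      HasSum (fun m => a m • (v m).smulRight (d m)) K ∧ ‖K‖ < 1 := by
  -- The norms of the weighted terms are dominated by a geometric series of sum `1 / 2`, and no
  -- weight is zero.
  let b : ℕ → ℝ := fun m => 1 / 2 / 2 / 2 ^ m / (1 + ‖v m‖ * ‖d m‖)
  have hb : ∀ m, 0 < b m := fun m => by positivity
  have hn : ∀ m, ‖(b m : 𝕜) • (v m).smulRight (d m)‖ ≤ 1 / 2 / 2 / 2 ^ m := fun m => by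
    rw [norm_smul, RCLike.norm_ofReal, abs_of_pos (hb m), ContinuousLinearMap.norm_smulRight_apply]
    have h : 0 ≤ ‖v m‖ * ‖d m‖ := by positivity
    calc b m * (‖v m‖ * ‖d m‖) ≤ b m * (1 + ‖v m‖ * ‖d m‖) := by
          gcongr
          linarith
      _ = 1 / 2 / 2 / 2 ^ m := by
          simp only [b]
          field_simp
  have hs : HasSum (fun m : ℕ => (1 / 2 : ℝ) / 2 / 2 ^ m) (1 / 2) := hasSum_geometric_two' (1 / 2)
  have hsum : Summable fun m => (b m : 𝕜) • (v m).smulRight (d m) :=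
    Summable.of_norm_bounded hs.summable hn
  refine ⟨fun m => b m, ∑' m, (b m : 𝕜) • (v m).smulRight (d m), fun m => ?_, hsum.hasSum, ?_⟩
  · exact RCLike.ofReal_ne_zero.2 (hb m).ne'
  · exact (tsum_of_norm_bounded hs hn).trans_lt (by norm_num)

theorem exists_inverse_one_add [CompleteSpace D] {K : D →L[𝕜] D} (hK : ‖K‖ < 1) :
    ∃ R : D →L[𝕜] D, (∀ f, R f + K (R f) = f) ∧ ∀ f, R (f + K f) = f := by
  obtain ⟨u, hu⟩ := isUnit_one_sub_of_norm_lt_one (x := -K) (by rwa [norm_neg])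
  have hu' : (u : D →L[𝕜] D) = 1 + K := by rw [hu, sub_neg_eq_add]
  refine ⟨(u⁻¹ : (D →L[𝕜] D)ˣ), fun f => ?_, fun f => ?_⟩
  · have h := congrArg (fun T : D →L[𝕜] D => T f) u.mul_inv
    rw [hu'] at h
    exact h
  · have h := congrArg (fun T : D →L[𝕜] D => T f) u.inv_mul
    rw [hu'] at h
    exact h

/-- If the derived set of `A` is the whole dual, then `A` is norming. -/
theorem exists_bound_of_weakStarDerivedSet_eq_univ {A : Submodule 𝕜 (StrongDual 𝕜 X)}
    (h : weakStarDerivedSet 𝕜 (A : Set (StrongDual 𝕜 X)) = Set.univ) :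
    ∃ C : ℝ, ∀ x, ‖evalOn A x‖ ≤ 1 → ‖x‖ ≤ C := by
  obtain ⟨C, hC⟩ := banach_steinhaus
    (g := fun x : {x : X // ‖evalOn A x‖ ≤ 1} => bidualEmbedding 𝕜 X x) (fun f => by
      obtain ⟨C, hC⟩ := mem_weakStarDerivedSet_iff.1
        (h ▸ Set.mem_univ (NormedDual.equiv 𝕜 X f) : NormedDual.equiv 𝕜 X f ∈ _)
      refine ⟨|C|, fun x => ?_⟩
      calc ‖NormedDual.equiv 𝕜 X f x‖ ≤ C * ‖evalOn A x‖ := hC x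
        _ ≤ |C| * 1 := mul_le_mul (le_abs_self C) x.2 (norm_nonneg _) (abs_nonneg C)
        _ = |C| := mul_one _)
  exact ⟨C, fun x hx => by simpa [norm_bidualEmbedding] using hC ⟨x, hx⟩⟩

/-- If `‖evalOn A (z j)‖ → 0` along unit vectors, then the derived set of `A` is proper. -/
theorem weakStarDerivedSet_ne_univ_of_tendsto {A : Submodule 𝕜 (StrongDual 𝕜 X)} {z : ℕ → X}
    (hz : ∀ j, ‖z j‖ = 1) (h : Tendsto (fun j => ‖evalOn A (z j)‖) atTop (𝓝 0)) :
    weakStarDerivedSet 𝕜 (A : Set (StrongDual 𝕜 X)) ≠ Set.univ := by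
  intro hu
  obtain ⟨C, hC⟩ := exists_bound_of_weakStarDerivedSet_eq_univ hu
  have hpos : 0 < 1 / (|C| + 1) := by positivity
  obtain ⟨j, hj⟩ := (h.eventually (gt_mem_nhds hpos)).exists
  have h1 := hC (((|C| + 1 : ℝ) : 𝕜) • z j) (by
    rw [map_smul, norm_smul, RCLike.norm_ofReal, abs_of_pos (by positivity)]
    rw [lt_div_iff₀ (by positivity)] at hj
    linarith)
  rw [norm_smul, RCLike.norm_ofReal, abs_of_pos (by positivity), hz] at h1
  linarith [le_abs_self C]

/-- The functionals that vanish on all `z j` after the perturbation `1 + K`. -/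
def perturbedAnnihilator (eD : D ≃ₗᵢ[𝕜] StrongDual 𝕜 X) (K : D →L[𝕜] D) (z : ℕ → X) :
    Submodule 𝕜 (StrongDual 𝕜 X) where
  carrier := {f | ∀ j, eD (eD.symm f + K (eD.symm f)) (z j) = 0}
  add_mem' {f g} hf hg j := by
    have h1 := hf j
    have h2 := hg j
    simp only [map_add, add_apply] at h1 h2 ⊢
    linear_combination h1 + h2
  zero_mem' := by simp
  smul_mem' c f hf j := by
    have h1 := hf j
    simp only [map_add, map_smul, add_apply, smul_apply, smul_eq_mul] at h1 ⊢
    linear_combination c * h1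

theorem mem_perturbedAnnihilator {eD : D ≃ₗᵢ[𝕜] StrongDual 𝕜 X} {K : D →L[𝕜] D} {z : ℕ → X}
    {f : D} : eD f ∈ perturbedAnnihilator eD K z ↔ ∀ j, eD (f + K f) (z j) = 0 := by
  change (∀ j, eD (eD.symm (eD f) + K (eD.symm (eD f))) (z j) = 0) ↔ _
  rw [eD.symm_apply_apply]

variable {eD : D ≃ₗᵢ[𝕜] StrongDual 𝕜 X} {K : D →L[𝕜] D} {z : ℕ → X} {v : ℕ → StrongDual 𝕜 D}
  {d : ℕ → D} {a : ℕ → 𝕜}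

/-- For `f` in the subspace, `f (z j) = -(K f) (z j)`. The first `j` terms of `K` contribute nothing
since their `d m` vanish at `z j`; the remaining tail has small operator norm. -/
theorem tendsto_norm_evalOn_perturbedAnnihilator (hz : ∀ j, ‖z j‖ = 1)
    (hK : HasSum (fun m => a m • (v m).smulRight (d m)) K)
    (hd : ∀ t, ∀ i < t, eD (d i) (z t) = 0) :
    Tendsto (fun j => ‖evalOn (perturbedAnnihilator eD K z) (z j)‖) atTop (𝓝 0) := by
  let S : ℕ → D →L[𝕜] D := fun N => ∑ m ∈ Finset.range N, a m • (v m).smulRight (d m)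
  have hS : Tendsto (fun N => ‖K - S N‖) atTop (𝓝 0) := by
    have h := hK.tendsto_sum_nat.const_sub K
    simpa using h.norm
  refine squeeze_zero (fun _ => norm_nonneg _) (fun j => ?_) hS
  refine ContinuousLinearMap.opNorm_le_bound _ (norm_nonneg _) fun f => ?_
  obtain ⟨f', hf'⟩ := eD.surjective (DualSubspace.incl _ f)
  have hmem := DualSubspace.incl_mem _ f
  rw [← hf'] at hmem
  have h0 := mem_perturbedAnnihilator.1 hmem j
  have hSz : eD (S j f') (z j) = 0 := by
    simp only [S, sum_apply, smul_apply, ContinuousLinearMap.smulRight_apply, map_sum, map_smul]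
    exact Finset.sum_eq_zero fun m hm => by rw [hd j m (Finset.mem_range.1 hm)]; simp
  have h1 : eD f' (z j) = -eD ((K - S j) f') (z j) := by
    simp only [map_add, map_sub, add_apply, sub_apply] at h0 ⊢
    rw [hSz]
    linear_combination h0
  rw [evalOn_apply, ← hf', h1, norm_neg, ← DualSubspace.norm_incl, ← hf', eD.norm_map]
  calc _ ≤ ‖eD ((K - S j) f')‖ * ‖z j‖ := ContinuousLinearMap.le_opNorm _ _
    _ = ‖(K - S j) f'‖ := by rw [eD.norm_map, hz, mul_one]
    _ ≤ _ := ContinuousLinearMap.le_opNorm _ _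

/-- Write `q` for the sum, the norm limit of `K (g t)`. As `R = 1 - R K`, the bounded elements `R (g
t)` of the subspace tend weak* to `γ - R q`. Since `K γ = 0`, `γ` itself is in the subspace;
subtract. -/
theorem apply_mem_weakStarDerivedSubmodule {R : D →L[𝕜] D} (hR : ∀ f, R f + K (R f) = f)
    (hR' : ∀ f, R (f + K f) = f) (hK : HasSum (fun m => a m • (v m).smulRight (d m)) K)
    {g : ℕ → D} {γ : D} {U : Ultrafilter ℕ} (hU : (U : Filter ℕ) ≤ atTop) {C : ℝ} {c : ℕ → 𝕜}
    {n : ℕ} (hc : ∀ m, n < m → c m = 0) (hgz : ∀ s t, eD (g s) (z t) = 0)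
    (hgC : ∀ᶠ t in U, ‖g t‖ ≤ C) (hvg : ∀ᶠ t in U, ∀ m ≤ t, v m (g t) = c m)
    (hgγ : ∀ x, Tendsto (fun t => eD (g t) x) U (𝓝 (eD γ x))) (hγz : ∀ t, eD γ (z t) = 0)
    (hvγ : ∀ m, v m γ = 0) :
    eD (R (∑ m ∈ Finset.range (n + 1), (a m * c m) • d m)) ∈
      weakStarDerivedSubmodule (perturbedAnnihilator eD K z) := by
  set q := ∑ m ∈ Finset.range (n + 1), (a m * c m) • d m with hq
  let S : ℕ → D →L[𝕜] D := fun N => ∑ m ∈ Finset.range N, a m • (v m).smulRight (d m)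
  have hS : Tendsto (fun N => ‖K - S N‖) atTop (𝓝 0) := by
    have h := hK.tendsto_sum_nat.const_sub K
    simpa using h.norm
  have hKγ : K γ = 0 := by
    have h := hK.mapL (ContinuousLinearMap.apply 𝕜 D γ)
    refine h.unique ?_
    convert hasSum_zero (α := D) (β := ℕ) using 2 with m
    simp [hvγ m]
  -- The values `v m (g t)` are known only for `m ≤ t`, hence the moving cutoff; the tail is small
  -- uniformly on the bounded `g t`.
  have hSq : ∀ᶠ t in U, S (t + 1) (g t) = q := by
    filter_upwards [hvg, hU (eventually_ge_atTop n)] with t ht hnt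
    have h1 : S (t + 1) (g t) = ∑ m ∈ Finset.range (t + 1), (a m * c m) • d m := by
      simp only [S, sum_apply, smul_apply, ContinuousLinearMap.smulRight_apply]
      refine Finset.sum_congr rfl fun m hm => ?_
      rw [ht m (Nat.lt_succ_iff.1 (Finset.mem_range.1 hm)), smul_smul]
    rw [h1, hq]
    symm
    refine Finset.sum_subset (Finset.range_mono (by omega)) fun m _ hm => ?_
    rw [Finset.mem_range] at hm
    rw [hc m (by omega), mul_zero, zero_smul]
  have hKg : Tendsto (fun t => K (g t)) U (𝓝 q) := by
    rw [tendsto_iff_norm_sub_tendsto_zero]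
    have h1 : Tendsto (fun t => ‖K - S (t + 1)‖ * C) U (𝓝 0) := by
      simpa using ((hS.comp (tendsto_add_atTop_nat 1)).mul_const C).mono_left hU
    refine squeeze_zero' (Eventually.of_forall fun _ => norm_nonneg _) ?_ h1
    filter_upwards [hSq, hgC] with t ht htC
    rw [← ht, ← sub_apply]
    exact ((K - S (t + 1)).le_opNorm _).trans (by gcongr)
  have hRg : ∀ f, R f = f - R (K f) := fun f => by
    rw [eq_sub_iff_add_eq, ← map_add, hR']
  have hmem : ∀ f, (∀ t, eD f (z t) = 0) → eD (R f) ∈ perturbedAnnihilator eD K z := fun f hf =>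
    mem_perturbedAnnihilator.2 fun j => by rw [hR]; exact hf j
  have h1 : eD (γ - R q) ∈ weakStarDerivedSubmodule (perturbedAnnihilator eD K z) := by
    refine mem_weakStarDerivedSet_of_tendsto (l := (U : Filter ℕ)) (f := fun t => eD (R (g t)))
      (C := ‖R‖ * C) (Eventually.of_forall fun t => hmem _ (hgz t)) ?_ fun x => ?_
    · filter_upwards [hgC] with t ht
      rw [eD.norm_map]
      exact (R.le_opNorm _).trans (by gcongr)
    · have h2 : Tendsto (fun t => eD (R (K (g t))) x) U (𝓝 (eD (R q) x)) :=
        ((ContinuousLinearMap.apply 𝕜 𝕜 x).continuous.comp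
          (eD.continuous.comp R.continuous)).continuousAt.tendsto.comp hKg
      have h3 := (hgγ x).sub h2
      rw [map_sub, sub_apply]
      refine h3.congr fun t => ?_
      rw [hRg (g t), map_sub, sub_apply]
  have h2 : eD γ ∈ weakStarDerivedSubmodule (perturbedAnnihilator eD K z) :=
    le_weakStarDerivedSubmodule _ <| mem_perturbedAnnihilator.2 fun j => by
      rw [hKγ, add_zero]; exact hγz j
  have h3 : eD (R q) = eD γ - eD (γ - R q) := by rw [← map_sub, sub_sub_cancel]
  rw [h3]
  exact Submodule.sub_mem _ h2 h1

theorem exists_dense_weakStarDerivedSet_ne_univ [CompleteSpace X] (hX : ¬ IsQuasiReflexive 𝕜 X)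
    {Z : Submodule 𝕜 X} (hZ : ¬ FiniteDimensional 𝕜 Z)
    (hsep : TopologicalSpace.SeparableSpace (StrongDual 𝕜 Z)) :
    ∃ A : Submodule 𝕜 (StrongDual 𝕜 X),
      weakStarDerivedSet 𝕜 (A : Set (StrongDual 𝕜 X)) ≠ Set.univ ∧
      Dense (weakStarDerivedSet 𝕜 (A : Set (StrongDual 𝕜 X))) := by
  let eD := NormedDual.equiv 𝕜 X
  let eV := NormedDual.equiv 𝕜 (NormedDual 𝕜 X)
  let J : X →L[𝕜] NormedDual 𝕜 (NormedDual 𝕜 X) :=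
    eV.symm.toContinuousLinearEquiv.toContinuousLinearMap ∘L bidualEmbedding 𝕜 X
  have hJ : ∀ x f, eV (J x) f = eD f x := fun x f => by simp [J, eD]
  have hJ1 : ∀ x, ‖J x‖ = ‖x‖ := fun x => by
    rw [← norm_bidualEmbedding (𝕜 := 𝕜) x]
    exact eV.symm.norm_map _
  obtain ⟨w, φ, hφJ, hφ1, hφ0⟩ := exists_triangular_system_of_not_cofinite J hJ1
    fun h => hX (isQuasiReflexive_iff_normedDual.2 h)
  obtain ⟨d, hd⟩ := exists_seq_approx_modulo_annihilator eD Z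
  obtain ⟨z, g, v, γ, U, hzZ, hz1, hdz, hgz, hU, hgC, hvg, hgγ, hγz, hvγ⟩ :=
    exists_asymptotic_system eD eV J hJ hJ1 hZ d w φ hφJ
  obtain ⟨a, K, ha, hK, hK1⟩ := exists_hasSum_rankOne_norm_lt_one v d
  obtain ⟨R, hR, hR'⟩ := exists_inverse_one_add hK1
  set A := perturbedAnnihilator eD K z with hA
  have hq : ∀ n, eD (R (∑ m ∈ Finset.range (n + 1), (a m * φ n (w m)) • d m)) ∈
      weakStarDerivedSubmodule A := fun n =>
    apply_mem_weakStarDerivedSubmodule hR hR' hK (hU n) (hφ0 · n) hgz (hgC n) (hvg n) (hgγ n)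
      (hγz n) (hvγ · n)
  -- Triangularity: in `hq n` the last term is `a n • R (d n)` with `a n ≠ 0`, and the others
  -- involve earlier `d m`.
  have hRd : ∀ n, eD (R (d n)) ∈ weakStarDerivedSubmodule A := by
    intro n
    induction n using Nat.strong_induction_on with
    | _ n ih =>
      have h1 := hq n
      rw [Finset.sum_range_succ, hφ1, mul_one, map_add, map_add, map_sum, map_sum] at h1
      have h2 : ∑ m ∈ Finset.range n, eD (R ((a m * φ n (w m)) • d m)) ∈
          weakStarDerivedSubmodule A := Submodule.sum_mem _ fun m hm => by
        rw [map_smul, map_smul]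
        exact Submodule.smul_mem _ _ (ih m (Finset.mem_range.1 hm))
      have h3 := (Submodule.add_mem_iff_right _ h2).1 h1
      rw [map_smul, map_smul] at h3
      exact (Submodule.smul_mem_iff _ (ha n)).1 h3
  refine ⟨A, weakStarDerivedSet_ne_univ_of_tendsto hz1
    (tendsto_norm_evalOn_perturbedAnnihilator hz1 hK hdz), fun f => ?_⟩
  rw [Metric.mem_closure_iff]
  intro ε hε
  obtain ⟨f, rfl⟩ := eD.surjective f
  -- Approximate `f + K f` rather than `f`, since `R` sends it back to `f`; the tolerance absorbs
  -- `‖R‖`.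
  obtain ⟨n, r, hr, hn⟩ := hd (f + K f) (ε / (‖R‖ + 1)) (by positivity)
  refine ⟨eD (R (d n + r)), ?_, ?_⟩
  · rw [map_add, map_add]
    exact (weakStarDerivedSubmodule A).add_mem (hRd n) <| le_weakStarDerivedSubmodule _ <|
      mem_perturbedAnnihilator.2 fun j => by rw [hR]; exact hr _ (hzZ j)
  · rw [eD.dist_map, dist_eq_norm, ← hR' f, ← map_sub]
    rw [lt_div_iff₀ (by positivity)] at hn
    calc ‖R (f + K f - (d n + r))‖ ≤ ‖R‖ * ‖f + K f - (d n + r)‖ := R.le_opNorm _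
      _ ≤ ‖f + K f - (d n + r)‖ * (‖R‖ + 1) := by
        nlinarith [norm_nonneg (f + K f - (d n + r))]
      _ < ε := hn

end Sufficiency

theorem theorem1 (𝕜 : Type*) [RCLike 𝕜] (X : Type*) [NormedAddCommGroup X] [NormedSpace 𝕜 X]
    [CompleteSpace X] :
    (∃ A : Submodule 𝕜 (StrongDual 𝕜 X),
        weakStarDerivedSet 𝕜 (A : Set (StrongDual 𝕜 X)) ≠ Set.univ ∧
        Dense (weakStarDerivedSet 𝕜 (A : Set (StrongDual 𝕜 X)))) ↔
      (¬ IsQuasiReflexive 𝕜 X ∧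
        ∃ Z : Submodule 𝕜 X, IsClosed (Z : Set X) ∧ ¬ FiniteDimensional 𝕜 Z ∧
          TopologicalSpace.SeparableSpace (StrongDual 𝕜 Z)) := by
  constructor
  · rintro ⟨A, hne, hd⟩
    exact ⟨not_isQuasiReflexive_of_dense hne hd, exists_subspace_separable_dual hne hd⟩
  · rintro ⟨hX, Z, -, hZ, hsep⟩
    exact exists_dense_weakStarDerivedSet_ne_univ hX hZ hsep
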